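/- Let $\beta\in[\tfrac12,2]$. The ordinary differential equation $$v''(\theta)+9v(\theta)=(\beta\cos^2\theta+\sin^2\theta)^{-5/2},\qquad \theta\in\mathbb R,$$ has exactly one $\pi$-periodic solution $v\in C^2(\mathbb R)$. For $x=(x_1,x_2)\in\mathbb R^2\setminus\{0\}$ with polar angle $\theta$ (which only matters modulo $\pi$, so $\theta=\arctan(x_2/x_1)$ if $x_1\ne0$ and $\theta=\pi/2$ if $x_1=0$) put $$P(x)=\frac{v(\theta)}{|x|^{3}},\qquad K(y)=9\,P\!\left(\frac{y_1}{\sqrt\beta},\,y_2\right)\quad(y\in\mathbb R^2\setminus\{0\}).$$ Let $\mathcal L u=\mathcal F^{-1}\!\left(\frac{|k|^3}{\beta k_1^2+k_2^2}\,\hat u(k)\right)$ be the Fourier multiplier operator with symbol $\frac{|k|^3}{\beta k_1^2+k_2^2}$, where $k$ is the angular frequency, that is, $\hat u(k)=\int_{\mathbb R^2}e^{-ik\cdot x}u(x)\,dx$ and $\mathcal F^{-1}g(x)=\frac1{(2\pi)^2}\int_{\mathbb R^2}e^{ik\cdot x}g(k)\,dk$. Then: 1. for every Schwartz function $u\in\mathcal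 S(\mathbb R^2)$, the function $\frac{|k|^3}{\beta k_1^2+k_2^2}\hat u(k)$ is integrable, and for every $x\in\mathbb R^2$, $$\mathcal L u(x)=-\frac1{4\pi}\int_{\mathbb R^2}\bigl(u(x+y)+u(x-y)-2u(x)\bigr)K(y)\,dy,$$ where the integral converges absolutely; 2. $K$ is homogeneous of degree $-3$: $K(ty)=t^{-3}K(y)$ for all $t>0$ and $y\ne0$; 3. $K$ is of class $C^2$ on $\mathbb R^2\setminus\{0\}$ and $$(\beta\partial_1^2+\partial_2^2)K(y)=\frac{9}{|y|^5}\qquad\text{for all }y\in\mathbb R^2\setminus\{0\}.$$ -/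

import Mathlib

open scoped SchwartzMap FourierTransform

noncomputable section

namespace PeierlsNabarro

/-- The plane `ℝ²` with its Euclidean norm. -/
abbrev Plane : Type := EuclideanSpace ℝ (Fin 2)

/-- `v` is a classical `π`-periodic solution of
`v'' + 9 v = (β cos² θ + sin² θ)^(-5/2)` on the real line. -/
def IsAngularProfile (β : ℝ) (v : ℝ → ℝ) : Prop :=
  ContDiff ℝ 2 v ∧ Function.Periodic v Real.pi ∧
    ∀ θ : ℝ, deriv (deriv v) θ + 9 * v θ =
      (β * Real.cos θ ^ 2 + Real.sin θ ^ 2) ^ (-(5 / 2) : ℝ)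

/-- The polar angle of a point of the plane. It agrees with `arctan (x₂ / x₁)` modulo `π`
when `x₁ ≠ 0`, and is `± π / 2` on the rest of the vertical axis. Only its value
modulo `π` matters below. -/
def angle (x : Plane) : ℝ := Complex.arg ⟨x 0, x 1⟩

/-- `P(x) = v(θ) / |x|³`, with `θ` the polar angle of `x`. -/
def P (v : ℝ → ℝ) (x : Plane) : ℝ := v (angle x) / ‖x‖ ^ 3

/-- `K(y) = 9 P(y₁ / √β, y₂)`. -/
def K (β : ℝ) (v : ℝ → ℝ) (y : Plane) : ℝ := 9 * P v !₂[y 0 / √β, y 1]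

/-- The second partial derivative `∂ᵢ² f` at `x`. -/
def secondPartial (i : Fin 2) (f : Plane → ℝ) (x : Plane) : ℝ :=
  lineDeriv ℝ (fun z => lineDeriv ℝ f z (EuclideanSpace.single i 1)) x
    (EuclideanSpace.single i 1)

/-- The symbol `|k|³ / (β k₁² + k₂²)`, as a function of the angular frequency `k`. -/
def symbol (β : ℝ) (k : Plane) : ℝ := ‖k‖ ^ 3 / (β * k 0 ^ 2 + k 1 ^ 2)

/-- `symbol(k) û(k)`. Mathlib's Fourier transform has the kernel `exp(-2πi x·ξ)`, so its variable
`ξ` corresponds to the angular frequency `k = 2πξ`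
(the one for which `∂ⱼ` has the symbol `i kⱼ`). -/
def multiplied (β : ℝ) (u : 𝓢(Plane, ℂ)) (ξ : Plane) : ℂ :=
  (symbol β ((2 * Real.pi) • ξ) : ℂ) * 𝓕 (u : Plane → ℂ) ξ

/-- The Fourier multiplier operator with symbol `|k|³ / (β k₁² + k₂²)`. -/
def multiplierOp (β : ℝ) (u : 𝓢(Plane, ℂ)) : Plane → ℂ := 𝓕⁻ (multiplied β u)

/-- `(u(x+y) + u(x-y) - 2u(x)) K(y)`. -/
def integrand (β : ℝ) (v : ℝ → ℝ) (u : 𝓢(Plane, ℂ)) (x y : Plane) : ℂ :=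
  (u (x + y) + u (x - y) - 2 * u x) * (K β v y : ℂ)

end PeierlsNabarro

end

noncomputable section

namespace PeierlsNabarro

/-! ### The angular profile in closed form -/

/-! Everything rests on a closed form. The equation for `v` is solved by a quartic form in `(cos θ,
sin θ)` divided by `√(β cos² θ + sin² θ)` (`profile_isAngularProfile`), and it has no other
`π`-periodic solution (`IsAngularProfile.unique`). Hence `K` is an explicit algebraic function
(`K_profile_eq_kernel`), from which homogeneity and smoothness are visible and the differential
equation becomes a polynomial identity (`kernel_pde`).

For the integral formula, the point is that the cosine transform `∫ (1 - cos (k·y)) K(y) dy` equals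
`2π` times the symbol (`integral_one_sub_cos_mul_kernel`). In polar coordinates the radial integral
is `∫ (1 - cos (a r)) / r² dr = π |a| / 2`, which leaves the angular integral of `|k·ω| K(ω)`. On
the circle `K = μ'' + μ` with `μ = 1 / (cos² + β sin²)`, while `|cos|'' + |cos|` is twice a sum of
point masses at the zeros of `cos`. The angular integral therefore only evaluates `μ` at right
angles to `k`, which produces `β k₁² + k₂²` (`integral_abs_cos_sub_mul_kernel`).

Finally, Fourier inversion writes `u(x+y) + u(x-y) - 2u(x)` as an integral of `-2 (1 - cos)` against
the transform of `u`, and Fubini's theorem gives the formula (`multiplier_integral_formula`). -/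

theorem hasDerivAt_div_pow_mul_sqrt {N D S : ℝ → ℝ} {N' D' S' t : ℝ} (m j : ℕ)
    (hN : HasDerivAt N N' t) (hD : HasDerivAt D D' t) (hS : HasDerivAt S S' t)
    (hD0 : D t ≠ 0) (hS0 : 0 < S t) :
    HasDerivAt (fun x => N x / (D x ^ m * S x ^ j * √(S x)))
      ((N' * D t * S t - m * N t * D' * S t - (j + 1 / 2) * N t * D t * S') /
        (D t ^ (m + 1) * S t ^ (j + 1) * √(S t))) t := by
  have hs : √(S t) ≠ 0 := (Real.sqrt_pos.2 hS0).ne'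
  have hsq : √(S t) ^ 2 = S t := Real.sq_sqrt hS0.le
  have hS1 : S t ≠ 0 := hS0.ne'
  refine (hN.div (((hD.pow m).mul (hS.pow j)).mul (hS.sqrt hS1)) ?_).congr_deriv ?_
  · simp only [Pi.mul_apply, Pi.pow_apply]
    positivity
  · simp only [Pi.mul_apply, Pi.pow_apply]
    -- For `m = 0` the truncated exponent `m - 1` is harmless, because the factor `m` vanishes.
    have e1 : (m : ℝ) * D t ^ (m - 1) = m * D t ^ m / D t := by
      cases m
      · simp
      · simp only [Nat.add_sub_cancel, pow_succ]; field_simp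
    have e2 : (j : ℝ) * S t ^ (j - 1) = j * S t ^ j / S t := by
      cases j
      · simp
      · simp only [Nat.add_sub_cancel, pow_succ]; field_simp
    rw [e1, e2]
    rw [div_eq_div_iff (by positivity) (by positivity)]
    field_simp
    rw [hsq]
    ring

/-- The quadratic form `β c² + s²`. -/
def profileForm (β θ : ℝ) : ℝ := β * Real.cos θ ^ 2 + Real.sin θ ^ 2

/-- The numerator of the closed form of the angular profile. -/
def profileNum (β θ : ℝ) : ℝ :=
  ((3 * β - 2 * β ^ 2) * Real.cos θ ^ 4 + (3 * β - 2) * Real.sin θ ^ 4 +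
    (6 * β ^ 2 - 10 * β + 6) * Real.cos θ ^ 2 * Real.sin θ ^ 2) / (9 * β ^ 2)

/-- The closed form of the `π`-periodic angular profile. -/
def profile (β θ : ℝ) : ℝ := profileNum β θ / √(profileForm β θ)

theorem profileForm_pos {β : ℝ} (hβ : 0 < β) (θ : ℝ) : 0 < profileForm β θ := by
  unfold profileForm
  by_cases h : Real.sin θ = 0
  · have := Real.sin_sq_add_cos_sq θ
    rw [h] at this ⊢
    nlinarith
  · positivity

/-- The derivative of `profileNum β`. -/
def profileNumDeriv (β θ : ℝ) : ℝ :=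
  (-4 * (3 * β - 2 * β ^ 2) * Real.cos θ ^ 3 * Real.sin θ
    + 4 * (3 * β - 2) * Real.sin θ ^ 3 * Real.cos θ +
    (6 * β ^ 2 - 10 * β + 6) * (2 * Real.cos θ ^ 3 * Real.sin θ
      - 2 * Real.cos θ * Real.sin θ ^ 3)) / (9 * β ^ 2)

/-- The second derivative of `profileNum β`. -/
def profileNumDerivTwo (β θ : ℝ) : ℝ :=
  (4 * (3 * β - 2 * β ^ 2) * (3 * Real.cos θ ^ 2 * Real.sin θ ^ 2 - Real.cos θ ^ 4)
    + 4 * (3 * β - 2) * (3 * Real.sin θ ^ 2 * Real.cos θ ^ 2 - Real.sin θ ^ 4) +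
    (6 * β ^ 2 - 10 * β + 6) * (2 * Real.cos θ ^ 4 - 12 * Real.cos θ ^ 2 * Real.sin θ ^ 2
      + 2 * Real.sin θ ^ 4)) / (9 * β ^ 2)

theorem hasDerivAt_profileForm (β θ : ℝ) :
    HasDerivAt (profileForm β) (2 * (1 - β) * Real.cos θ * Real.sin θ) θ := by
  unfold profileForm
  refine ((((Real.hasDerivAt_cos θ).pow 2).const_mul β).add
    ((Real.hasDerivAt_sin θ).pow 2)).congr_deriv ?_
  simp; ring

theorem hasDerivAt_profileNum (β θ : ℝ) :
    HasDerivAt (profileNum β) (profileNumDeriv β θ) θ := by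
  unfold profileNum profileNumDeriv
  refine ((((((Real.hasDerivAt_cos θ).pow 4).const_mul _).add
    (((Real.hasDerivAt_sin θ).pow 4).const_mul _)).add
    ((((Real.hasDerivAt_cos θ).pow 2).const_mul _).mul
      ((Real.hasDerivAt_sin θ).pow 2))).div_const _).congr_deriv ?_
  simp; ring

theorem hasDerivAt_profileNumDeriv (β θ : ℝ) :
    HasDerivAt (profileNumDeriv β) (profileNumDerivTwo β θ) θ := by
  unfold profileNumDeriv profileNumDerivTwo
  have hc (n : ℕ) := (Real.hasDerivAt_cos θ).pow n
  have hs (n : ℕ) := (Real.hasDerivAt_sin θ).pow n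
  refine ((((((hc 3).const_mul _).mul (Real.hasDerivAt_sin θ)).add
    (((hs 3).const_mul _).mul (Real.hasDerivAt_cos θ))).add
    (((((hc 3).const_mul 2).mul (Real.hasDerivAt_sin θ)).sub
      (((Real.hasDerivAt_cos θ).const_mul 2).mul (hs 3))).const_mul _)).div_const _).congr_deriv ?_
  simp; ring

theorem hasDerivAt_profile {β : ℝ} (hβ : 0 < β) (θ : ℝ) :
    HasDerivAt (profile β)
      ((profileNumDeriv β θ * profileForm β θ
        - profileNum β θ * ((1 - β) * Real.cos θ * Real.sin θ)) /
        (profileForm β θ ^ 1 * √(profileForm β θ))) θ := by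
  have h := hasDerivAt_div_pow_mul_sqrt 0 0 (hasDerivAt_profileNum β θ)
    (hasDerivAt_const θ (1 : ℝ)) (hasDerivAt_profileForm β θ) one_ne_zero (profileForm_pos hβ θ)
  convert h using 1
  · ext; simp [profile]
  · simp; ring

theorem profile_ode {β : ℝ} (hβ : 0 < β) (θ : ℝ) :
    deriv (deriv (profile β)) θ + 9 * profile β θ =
      (β * Real.cos θ ^ 2 + Real.sin θ ^ 2) ^ (-(5 / 2) : ℝ) := by
  have hd : deriv (profile β) = fun θ => ((profileNumDeriv β θ * profileForm β θ
        - profileNum β θ * ((1 - β) * Real.cos θ * Real.sin θ)) /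
        (profileForm β θ ^ 1 * √(profileForm β θ))) :=
    funext fun θ => (hasDerivAt_profile hβ θ).deriv
  have h2 := ((hasDerivAt_profileNumDeriv β θ).mul (hasDerivAt_profileForm β θ)).sub
    ((hasDerivAt_profileNum β θ).mul
      (((Real.hasDerivAt_cos θ).const_mul (1 - β)).mul (Real.hasDerivAt_sin θ)))
  have h := hasDerivAt_div_pow_mul_sqrt 0 1 h2
    (hasDerivAt_const θ (1 : ℝ)) (hasDerivAt_profileForm β θ) one_ne_zero (profileForm_pos hβ θ)
  have hpos := profileForm_pos hβ θ
  rw [hd, (h.congr_of_eventuallyEq (Filter.Eventually.of_forall fun x => by simp)).deriv]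
  change _ = (profileForm β θ) ^ (-(5 / 2) : ℝ)
  have er : (profileForm β θ) ^ (-(5 / 2) : ℝ) = 1 / (profileForm β θ ^ 2 * √(profileForm β θ)) := by
    rw [Real.rpow_neg hpos.le, Real.sqrt_eq_rpow, ← Real.rpow_natCast, ← Real.rpow_add hpos]
    norm_num
  rw [er]
  have hs : √(profileForm β θ) ≠ 0 := (Real.sqrt_pos.2 hpos).ne'
  have hp := hpos.ne'
  -- Differentiation preserves the degree of a form in `cos θ` and `sin θ`, so the combined
  -- numerator is a form of degree 8. It equals `(c² + s²)⁴` as a polynomial, and `ring` needs no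
  -- trigonometric relation.
  have hsc : (Real.cos θ ^ 2 + Real.sin θ ^ 2) ^ 4 = 1 := by rw [Real.cos_sq_add_sin_sq, one_pow]
  have e9 : 9 * profile β θ = 9 * profileNum β θ * profileForm β θ ^ 2 /
      (profileForm β θ ^ 2 * √(profileForm β θ)) := by
    rw [profile]; field_simp
  simp only [Pi.mul_apply, Pi.sub_apply, Nat.cast_zero, Nat.cast_one, one_pow, one_mul, mul_one,
    Nat.reduceAdd, zero_mul, sub_zero, mul_zero]
  rw [e9, ← add_div]
  congr 1
  refine Eq.trans ?_ hsc
  simp only [profileForm, profileNum, profileNumDeriv, profileNumDerivTwo]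
  field_simp
  ring

theorem profile_isAngularProfile {β : ℝ} (hβ : 0 < β) : IsAngularProfile β (profile β) := by
  refine ⟨?_, fun θ => ?_, profile_ode hβ⟩
  · unfold profile
    refine ContDiff.div (by unfold profileNum; fun_prop) ?_ fun θ => ?_
    · exact ContDiff.sqrt (by unfold profileForm; fun_prop) fun θ => (profileForm_pos hβ θ).ne'
    · exact (Real.sqrt_pos.2 (profileForm_pos hβ θ)).ne'
  · simp only [profile, profileNum, profileForm, Real.cos_add_pi, Real.sin_add_pi, neg_sq,
      Even.neg_pow (by decide : Even 4)]

/-- Solutions of `f'' + 9 f = 0` are spanned by `cos 3θ` and `sin 3θ`, which change sign under `θ ↦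
θ + π`. None but zero is `π`-periodic. -/
theorem IsAngularProfile.unique {β : ℝ} {v w : ℝ → ℝ} (hv : IsAngularProfile β v)
    (hw : IsAngularProfile β w) : v = w := by
  obtain ⟨hv, hvp, hvo⟩ := hv
  obtain ⟨hw, hwp, hwo⟩ := hw
  have key (f : ℝ → ℝ) (hf : ContDiff ℝ 2 f) (x : ℝ) :
      HasDerivAt f (deriv f x) x ∧ HasDerivAt (deriv f) (deriv (deriv f) x) x := by
    refine ⟨(hf.differentiable (by norm_num) x).hasDerivAt, ?_⟩
    have : ContDiff ℝ 1 (deriv f) := by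
      have := (contDiff_succ_iff_deriv (n := 1) (f := f)).1 (by norm_num; exact hf)
      exact this.2.2
    exact (this.differentiable (by norm_num) x).hasDerivAt
  funext s
  -- The value at `s` of the homogeneous solution, recovered from its data at `θ`; hence constant.
  -- Between `s` and `s + π` periodicity turns it into its negative.
  let A : ℝ → ℝ := fun θ => (v θ - w θ) * Real.cos (3 * (θ - s))
    - (deriv v θ - deriv w θ) * Real.sin (3 * (θ - s)) / 3
  have hA (θ : ℝ) : HasDerivAt A 0 θ := by
    have h3 : HasDerivAt (fun θ => 3 * (θ - s)) 3 θ := by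
      simpa using ((hasDerivAt_id θ).sub_const s).const_mul 3
    refine ((((key v hv θ).1.sub (key w hw θ).1).mul h3.cos).sub
      ((((key v hv θ).2.sub (key w hw θ).2).mul h3.sin).div_const 3)).congr_deriv ?_
    have := hvo θ
    have := hwo θ
    have e : deriv (deriv v) θ - deriv (deriv w) θ = -9 * (v θ - w θ) := by linarith
    simp only [Pi.sub_apply]
    rw [e]; ring
  have hc := is_const_of_deriv_eq_zero (fun θ => (hA θ).differentiableAt)
    (fun θ => (hA θ).deriv) s (s + Real.pi)
  have hcos : Real.cos (3 * Real.pi) = -1 := by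
    rw [show 3 * Real.pi = Real.pi + 2 * Real.pi by ring, Real.cos_add_two_pi, Real.cos_pi]
  have hsin : Real.sin (3 * Real.pi) = 0 := by exact_mod_cast Real.sin_nat_mul_pi 3
  simp only [A, sub_self, mul_zero, Real.cos_zero, Real.sin_zero, add_sub_cancel_left, hcos,
    hsin, hvp s, hwp s] at hc
  linarith

end PeierlsNabarro

end

noncomputable section

namespace PeierlsNabarro

/-! ### The kernel in closed form -/

/-- The quadratic form `a² + β b²`. -/
def kernelForm (β a b : ℝ) : ℝ := a ^ 2 + β * b ^ 2

/-- The numerator of the closed form of the kernel `K`. -/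
def kernelNum (β a b : ℝ) : ℝ :=
  (3 - 2 * β) * a ^ 4 + (3 * β ^ 2 - 2 * β) * b ^ 4 + (6 * β ^ 2 - 10 * β + 6) * a ^ 2 * b ^ 2

/-- The closed form of the kernel `K`, in coordinates. -/
def kernel (β a b : ℝ) : ℝ := kernelNum β a b / (kernelForm β a b ^ 3 * √(a ^ 2 + b ^ 2))

theorem Plane.norm_eq (y : Plane) : ‖y‖ = √(y 0 ^ 2 + y 1 ^ 2) := by
  simp [EuclideanSpace.norm_eq, Fin.sum_univ_two]

theorem Plane.sq_add_sq_pos {y : Plane} (hy : y ≠ 0) : 0 < y 0 ^ 2 + y 1 ^ 2 := by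
  have := norm_pos_iff.2 hy
  rw [Plane.norm_eq] at this
  exact Real.sqrt_pos.1 this

theorem kernelForm_pos {β a b : ℝ} (hβ : 0 < β) (h : 0 < a ^ 2 + b ^ 2) :
    0 < kernelForm β a b := by
  unfold kernelForm
  by_cases ha : a = 0
  · subst ha
    have : 0 < b ^ 2 := by simpa using h
    positivity
  · positivity

/-- With `r = |(a/√β, b)|`, the angle has cosine `a/(√β r)` and sine `b/r`. So the form under the
root becomes `(a² + b²)/r²`, and `β r² = a² + β b²`. -/
theorem K_profile_eq_kernel {β : ℝ} (hβ : 0 < β) (y : Plane) :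
    K β (profile β) y = kernel β (y 0) (y 1) := by
  -- At the origin both sides are `0` since division by zero gives `0`; the identity thus holds
  -- between functions on the whole plane.
  by_cases hy : y = 0
  · subst hy
    have : (!₂[(0 : ℝ) / √β, 0] : Plane) = 0 := by
      ext i; fin_cases i <;> simp
    simp only [K, P, PiLp.zero_apply, this]
    simp [kernel]
  have hS := Plane.sq_add_sq_pos hy
  have hD := kernelForm_pos hβ hS
  have hb : 0 < √β := Real.sqrt_pos.2 hβ
  have hb2 : √β ^ 2 = β := Real.sq_sqrt hβ.le
  set a := y 0
  set b := y 1
  set r := √((a / √β) ^ 2 + b ^ 2) with hr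
  have hrD : kernelForm β a b = β * ((a / √β) ^ 2 + b ^ 2) := by
    rw [div_pow, hb2, kernelForm]; field_simp
  have hrpos : 0 < (a / √β) ^ 2 + b ^ 2 := by
    rw [hrD] at hD
    exact pos_of_mul_pos_right hD hβ.le
  have hr0 : 0 < r := Real.sqrt_pos.2 hrpos
  have hr2 : r ^ 2 = a ^ 2 / β + b ^ 2 := by rw [hr, Real.sq_sqrt hrpos.le, div_pow, hb2]
  have hz : (⟨a / √β, b⟩ : ℂ) ≠ 0 := by
    intro h
    have h1 := congrArg Complex.re h
    have h2 := congrArg Complex.im h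
    simp only [Complex.zero_re, Complex.zero_im] at h1 h2
    rw [h1, h2] at hrpos
    simp at hrpos
  have hnz : ‖(⟨a / √β, b⟩ : ℂ)‖ = r := by
    rw [Complex.norm_def, Complex.normSq_apply, hr]; congr 1; ring
  have hnp : ‖(!₂[a / √β, b] : Plane)‖ = r := by rw [Plane.norm_eq, hr]; simp
  have hang : angle !₂[a / √β, b] = Complex.arg ⟨a / √β, b⟩ := by simp [angle]
  have hQ : √(profileForm β (Complex.arg ⟨a / √β, b⟩)) = √(a ^ 2 + b ^ 2) / r := by
    rw [profileForm, Complex.cos_arg hz, Complex.sin_arg, hnz]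
    have : β * (a / √β / r) ^ 2 + (b / r) ^ 2 = (a ^ 2 + b ^ 2) / r ^ 2 := by
      rw [div_pow, div_pow, hb2]; field_simp
    rw [this, Real.sqrt_div hS.le, Real.sqrt_sq hr0.le]
  have hN : profileNum β (Complex.arg ⟨a / √β, b⟩) =
      kernelNum β a b / (9 * β ^ 3 * r ^ 4) := by
    rw [profileNum, Complex.cos_arg hz, Complex.sin_arg, hnz, kernelNum]
    simp only [div_pow, show √β ^ 4 = β ^ 2 by rw [show √β ^ 4 = (√β ^ 2) ^ 2 by ring, hb2], hb2]
    field_simp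
  have hs : √(a ^ 2 + b ^ 2) ≠ 0 := (Real.sqrt_pos.2 hS).ne'
  have hD' : kernelForm β a b = β * r ^ 2 := by rw [hr2, kernelForm]; field_simp
  rw [K, P, hang, hnp, profile, hQ, hN, kernel, hD']
  field_simp

theorem kernel_smul (β : ℝ) {t : ℝ} (ht : 0 < t) (a b : ℝ) :
    kernel β (t * a) (t * b) = (t ^ 3)⁻¹ * kernel β a b := by
  have h1 : kernelForm β (t * a) (t * b) = t ^ 2 * kernelForm β a b := by
    unfold kernelForm; ring
  have h2 : √((t * a) ^ 2 + (t * b) ^ 2) = t * √(a ^ 2 + b ^ 2) := by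
    rw [← Real.sqrt_sq ht.le, ← Real.sqrt_mul (sq_nonneg _), Real.sqrt_sq ht.le]
    congr 1; ring
  have h3 : kernelNum β (t * a) (t * b) = t ^ 4 * kernelNum β a b := by
    unfold kernelNum; ring
  rw [kernel, kernel, h1, h2, h3, inv_mul_eq_div, div_div,
    show (t ^ 2 * kernelForm β a b) ^ 3 * (t * √(a ^ 2 + b ^ 2)) =
      t ^ 4 * (kernelForm β a b ^ 3 * √(a ^ 2 + b ^ 2) * t ^ 3) by ring,
    mul_div_mul_left _ _ (by positivity)]

theorem contDiffOn_kernel {β : ℝ} (hβ : 0 < β) :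
    ContDiffOn ℝ 2 (fun y : Plane => kernel β (y 0) (y 1)) {0}ᶜ := by
  intro y hy
  have hS := Plane.sq_add_sq_pos (show y ≠ 0 from hy)
  have hD := kernelForm_pos hβ hS
  have h0 : ContDiffAt ℝ 2 (fun z : Plane => z 0) y := by fun_prop
  have h1 : ContDiffAt ℝ 2 (fun z : Plane => z 1) y := by fun_prop
  have hs : ContDiffAt ℝ 2 (fun z : Plane => √(z 0 ^ 2 + z 1 ^ 2)) y :=
    ContDiffAt.sqrt (by fun_prop) hS.ne'
  have hN : ContDiffAt ℝ 2 (fun z : Plane => kernelNum β (z 0) (z 1)) y := by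
    unfold kernelNum; fun_prop
  have hF : ContDiffAt ℝ 2 (fun z : Plane => kernelForm β (z 0) (z 1)) y := by
    unfold kernelForm; fun_prop
  have := Real.sqrt_pos.2 hS
  exact (hN.div ((hF.pow 3).mul hs) (by positivity)).contDiffWithinAt

/-- The outer derivative sees the inner one only near `y`, so a formula valid off the origin is
enough. -/
theorem secondPartial_eq {i : Fin 2} {f f₁ : Plane → ℝ} {f₂ : ℝ} {y : Plane} (hy : y ≠ 0)
    (h₁ : ∀ z ≠ 0, HasLineDerivAt ℝ f (f₁ z) z (EuclideanSpace.single i 1))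
    (h₂ : HasLineDerivAt ℝ f₁ f₂ y (EuclideanSpace.single i 1)) :
    secondPartial i f y = f₂ := by
  refine HasLineDerivAt.lineDeriv (h₂.congr_of_eventuallyEq ?_)
  filter_upwards [isOpen_ne.mem_nhds hy] with z hz using (h₁ z hz).lineDeriv

/-- The second derivative of `x ↦ N x / (D x ^ 3 * √(S x))`. -/
theorem secondPartial_div_pow_mul_sqrt {i : Fin 2} {N N' D D' S S' : Plane → ℝ} {N'' D'' S'' : ℝ}
    (hN : ∀ z, HasLineDerivAt ℝ N (N' z) z (EuclideanSpace.single i 1))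
    (hD : ∀ z, HasLineDerivAt ℝ D (D' z) z (EuclideanSpace.single i 1))
    (hS : ∀ z, HasLineDerivAt ℝ S (S' z) z (EuclideanSpace.single i 1))
    (hD0 : ∀ z ≠ 0, D z ≠ 0) (hS0 : ∀ z ≠ 0, 0 < S z) {y : Plane} (hy : y ≠ 0)
    (hN' : HasLineDerivAt ℝ N' N'' y (EuclideanSpace.single i 1))
    (hD' : HasLineDerivAt ℝ D' D'' y (EuclideanSpace.single i 1))
    (hS' : HasLineDerivAt ℝ S' S'' y (EuclideanSpace.single i 1)) :
    secondPartial i (fun z => N z / (D z ^ 3 * √(S z))) y =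
      (N'' * D y ^ 2 * S y ^ 2 - 6 * N' y * D' y * D y * S y ^ 2 - N' y * D y ^ 2 * S y * S' y
        - 3 * N y * D y * D'' * S y ^ 2 + 12 * N y * D' y ^ 2 * S y ^ 2
        + 3 * N y * D y * D' y * S y * S' y - N y * D y ^ 2 * S y * S'' / 2
        + 3 / 4 * N y * D y ^ 2 * S' y ^ 2) / (D y ^ 5 * S y ^ 2 * √(S y)) := by
  have at0 (z v : Plane) : z + (0 : ℝ) • v = z := by simp
  refine secondPartial_eq (f₁ := fun z => (N' z * D z * S z - 3 * N z * D' z * S z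
    - 1 / 2 * N z * D z * S' z) / (D z ^ 4 * S z ^ 1 * √(S z))) hy (fun z hz => ?_) ?_
  · have h := hasDerivAt_div_pow_mul_sqrt 3 0 (hN z) (hD z) (hS z)
      (by simpa using hD0 z hz) (by simpa using hS0 z hz)
    simp only [at0] at h
    refine (h.congr_deriv ?_).congr_of_eventuallyEq (Filter.Eventually.of_forall fun x => by simp)
    norm_num
  · have hP : HasLineDerivAt ℝ (fun z => N' z * D z * S z - 3 * N z * D' z * S z
        - 1 / 2 * N z * D z * S' z) _ y _ :=
      (((hN'.fun_mul (hD y)).fun_mul (hS y)).fun_sub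
      ((((hN y).const_mul 3).fun_mul hD').fun_mul (hS y))).fun_sub
      ((((hN y).const_mul (1 / 2)).fun_mul (hD y)).fun_mul hS')
    have h := hasDerivAt_div_pow_mul_sqrt 4 1 hP (hD y) (hS y)
      (by simpa using hD0 y hy) (by simpa using hS0 y hy)
    simp only [at0] at h
    refine h.congr_deriv ?_
    norm_num
    ring

theorem hasLineDerivAt_zero {g : ℝ → ℝ → ℝ} {g' : ℝ} {z : Plane}
    (h : HasDerivAt (fun a => g a (z 1)) g' (z 0)) :
    HasLineDerivAt ℝ (fun w : Plane => g (w 0) (w 1)) g' z (EuclideanSpace.single 0 1) := by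
  have h' : HasDerivAt (fun a => g a (z 1)) g' (z 0 + 0) := by simpa using h
  simpa [HasLineDerivAt] using h'.comp_const_add (z 0) 0

theorem hasLineDerivAt_one {g : ℝ → ℝ → ℝ} {g' : ℝ} {z : Plane}
    (h : HasDerivAt (fun b => g (z 0) b) g' (z 1)) :
    HasLineDerivAt ℝ (fun w : Plane => g (w 0) (w 1)) g' z (EuclideanSpace.single 1 1) := by
  have h' : HasDerivAt (fun b => g (z 0) b) g' (z 1 + 0) := by simpa using h
  simpa [HasLineDerivAt] using h'.comp_const_add (z 1) 0

theorem hasDerivAt_quartic (p q r x : ℝ) :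
    HasDerivAt (fun x => p * x ^ 4 + q * x ^ 2 + r) (4 * p * x ^ 3 + 2 * q * x) x := by
  refine ((((hasDerivAt_pow 4 x).const_mul p).add
    ((hasDerivAt_pow 2 x).const_mul q)).add_const r).congr_deriv ?_
  simp; ring

theorem hasDerivAt_cubic (p q x : ℝ) :
    HasDerivAt (fun x => p * x ^ 3 + q * x) (3 * p * x ^ 2 + q) x := by
  refine (((hasDerivAt_pow 3 x).const_mul p).add ((hasDerivAt_id x).const_mul q)).congr_deriv ?_
  simp; ring

/-- Over the common denominator `D⁵ S² √S`, with `D = a² + β b²` and `S = a² + b²`, the claim is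
that a polynomial numerator of degree 10 equals `9 D⁵`. -/
theorem kernel_pde {β : ℝ} (hβ : 0 < β) {y : Plane} (hy : y ≠ 0) :
    β * secondPartial 0 (fun y : Plane => kernel β (y 0) (y 1)) y +
      secondPartial 1 (fun y : Plane => kernel β (y 0) (y 1)) y = 9 / ‖y‖ ^ 5 := by
  have hS := Plane.sq_add_sq_pos hy
  have hD := kernelForm_pos hβ hS
  set c := 6 * β ^ 2 - 10 * β + 6 with hc
  have hD0 : ∀ z : Plane, z ≠ 0 → kernelForm β (z 0) (z 1) ≠ 0 := fun z hz =>
    (kernelForm_pos hβ (Plane.sq_add_sq_pos hz)).ne'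
  have hS0 : ∀ z : Plane, z ≠ 0 → 0 < z 0 ^ 2 + z 1 ^ 2 := fun z hz => Plane.sq_add_sq_pos hz
  have e0 := secondPartial_div_pow_mul_sqrt (i := 0)
    (N := fun z => kernelNum β (z 0) (z 1))
    (N' := fun z => 4 * (3 - 2 * β) * z 0 ^ 3 + 2 * c * z 1 ^ 2 * z 0)
    (N'' := 3 * (4 * (3 - 2 * β)) * y 0 ^ 2 + 2 * c * y 1 ^ 2)
    (D := fun z => kernelForm β (z 0) (z 1)) (D' := fun z => 2 * z 0) (D'' := 2)
    (S := fun z => z 0 ^ 2 + z 1 ^ 2) (S' := fun z => 2 * z 0) (S'' := 2)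
    (fun z => hasLineDerivAt_zero <| by
      convert hasDerivAt_quartic (3 - 2 * β) (c * z 1 ^ 2) ((3 * β ^ 2 - 2 * β) * z 1 ^ 4) (z 0)
        using 1
      · ext; simp only [kernelNum, hc]; ring
      · ring)
    (fun z => hasLineDerivAt_zero <| by
      convert hasDerivAt_quartic 0 1 (β * z 1 ^ 2) (z 0) using 1
      · ext; simp only [kernelForm]; ring
      · ring)
    (fun z => hasLineDerivAt_zero (g := fun a b => a ^ 2 + b ^ 2) <| by
      convert hasDerivAt_quartic 0 1 (z 1 ^ 2) (z 0) using 1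
      · ext; ring
      · ring)
    hD0 hS0 hy
    (hasLineDerivAt_zero (g := fun a b => 4 * (3 - 2 * β) * a ^ 3 + 2 * c * b ^ 2 * a) <|
      hasDerivAt_cubic _ _ _)
    (hasLineDerivAt_zero (g := fun a _ => 2 * a) <| by
      simpa using (hasDerivAt_id (y 0)).const_mul 2)
    (hasLineDerivAt_zero (g := fun a _ => 2 * a) <| by
      simpa using (hasDerivAt_id (y 0)).const_mul 2)
  have e1 := secondPartial_div_pow_mul_sqrt (i := 1)
    (N := fun z => kernelNum β (z 0) (z 1))
    (N' := fun z => 4 * (3 * β ^ 2 - 2 * β) * z 1 ^ 3 + 2 * c * z 0 ^ 2 * z 1)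
    (N'' := 3 * (4 * (3 * β ^ 2 - 2 * β)) * y 1 ^ 2 + 2 * c * y 0 ^ 2)
    (D := fun z => kernelForm β (z 0) (z 1)) (D' := fun z => 2 * β * z 1) (D'' := 2 * β)
    (S := fun z => z 0 ^ 2 + z 1 ^ 2) (S' := fun z => 2 * z 1) (S'' := 2)
    (fun z => hasLineDerivAt_one <| by
      convert hasDerivAt_quartic (3 * β ^ 2 - 2 * β) (c * z 0 ^ 2) ((3 - 2 * β) * z 0 ^ 4) (z 1)
        using 1
      · ext; simp only [kernelNum, hc]; ring
      · ring)
    (fun z => hasLineDerivAt_one <| by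
      convert hasDerivAt_quartic 0 β (z 0 ^ 2) (z 1) using 1
      · ext; simp only [kernelForm]; ring
      · ring)
    (fun z => hasLineDerivAt_one (g := fun a b => a ^ 2 + b ^ 2) <| by
      convert hasDerivAt_quartic 0 1 (z 0 ^ 2) (z 1) using 1
      · ext; ring
      · ring)
    hD0 hS0 hy
    (hasLineDerivAt_one
      (g := fun a b => 4 * (3 * β ^ 2 - 2 * β) * b ^ 3 + 2 * c * a ^ 2 * b) <|
      hasDerivAt_cubic _ _ _)
    (hasLineDerivAt_one (g := fun _ b => 2 * β * b) <| by
      simpa using (hasDerivAt_id (y 1)).const_mul (2 * β))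
    (hasLineDerivAt_one (g := fun _ b => 2 * b) <| by
      simpa using (hasDerivAt_id (y 1)).const_mul 2)
  simp only [kernel]
  rw [e0, e1]
  have hn : ‖y‖ ^ 5 = (y 0 ^ 2 + y 1 ^ 2) ^ 2 * √(y 0 ^ 2 + y 1 ^ 2) := by
    have := Real.sq_sqrt hS.le
    rw [Plane.norm_eq, ← congrArg (· ^ 2) this]
    ring
  have hs := Real.sqrt_pos.2 hS
  rw [hn, mul_div_assoc', ← add_div, div_eq_div_iff (by positivity) (by positivity)]
  rw [show 9 * (kernelForm β (y 0) (y 1) ^ 5 * (y 0 ^ 2 + y 1 ^ 2) ^ 2 * √(y 0 ^ 2 + y 1 ^ 2)) =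
    (9 * kernelForm β (y 0) (y 1) ^ 5) * ((y 0 ^ 2 + y 1 ^ 2) ^ 2 * √(y 0 ^ 2 + y 1 ^ 2)) by ring]
  congr 1
  simp only [kernelForm, kernelNum, hc]
  ring

end PeierlsNabarro

end

noncomputable section

namespace PeierlsNabarro

open MeasureTheory Set Filter Topology

/-! ### The radial integral -/

theorem lintegral_mul_exp_neg_mul {r : ℝ} (hr : 0 < r) :
    ∫⁻ t in Ioi (0 : ℝ), ENNReal.ofReal (t * Real.exp (-(r * t))) =
      ENNReal.ofReal (1 / r ^ 2) := by
  have h := Real.integral_rpow_mul_exp_neg_mul_Ioi (a := 2) (by norm_num) hr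
  have e : ∀ t ∈ Ioi (0 : ℝ), t ^ ((2 : ℝ) - 1) * Real.exp (-(r * t)) =
      t * Real.exp (-(r * t)) := fun t _ => by norm_num
  rw [setIntegral_congr_fun measurableSet_Ioi e] at h
  have hG : Real.Gamma 2 = 1 := by simp
  rw [hG, mul_one, show (1 / r) ^ (2 : ℝ) = 1 / r ^ 2 by norm_num] at h
  rw [← h, ofReal_integral_eq_lintegral_ofReal]
  -- A nonzero Bochner integral forces integrability.
  · refine not_imp_comm.1 integral_undef ?_
    rw [h]; positivity
  · filter_upwards [ae_restrict_mem measurableSet_Ioi] with t ht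
    exact mul_nonneg (le_of_lt ht) (Real.exp_nonneg _)

theorem lintegral_exp_mul_one_sub_cos {t : ℝ} (ht : 0 < t) :
    ∫⁻ r in Ioi (0 : ℝ), ENNReal.ofReal (t * Real.exp (-(r * t)) * (1 - Real.cos r)) =
      ENNReal.ofReal ((1 + t ^ 2)⁻¹) := by
  -- A primitive of the integrand that tends to `0` at infinity, with `G 0 = -1 / (1 + t²)`.
  let G : ℝ → ℝ := fun r =>
    -(Real.exp (-(r * t)) * (1 + t * (Real.sin r - t * Real.cos r) / (1 + t ^ 2)))
  have ht2 : (1 + t ^ 2) ≠ 0 := by positivity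
  have hd (r : ℝ) : HasDerivAt G (t * Real.exp (-(r * t)) * (1 - Real.cos r)) r := by
    have h1 : HasDerivAt (fun r => Real.exp (-(r * t))) (Real.exp (-(r * t)) * (-(1 * t))) r :=
      ((hasDerivAt_id r).mul_const t).fun_neg.exp
    have h2 : HasDerivAt (fun r => 1 + t * (Real.sin r - t * Real.cos r) / (1 + t ^ 2))
        (t * (Real.cos r - t * (-Real.sin r)) / (1 + t ^ 2)) r :=
      ((((Real.hasDerivAt_sin r).sub ((Real.hasDerivAt_cos r).const_mul t)).const_mul
        t).div_const _).const_add 1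
    refine (h1.mul h2).neg.congr_deriv ?_
    field_simp
    ring
  have hnn : ∀ r ∈ Ioi (0 : ℝ), 0 ≤ t * Real.exp (-(r * t)) * (1 - Real.cos r) := fun r _ =>
    mul_nonneg (by positivity) (by linarith [Real.cos_le_one r])
  have hlim : Tendsto G atTop (𝓝 0) := by
    have he : Tendsto (fun r : ℝ => Real.exp (-(r * t))) atTop (𝓝 0) :=
      Real.tendsto_exp_neg_atTop_nhds_zero.comp (tendsto_id.atTop_mul_const ht)
    rw [← neg_zero]
    refine Tendsto.neg (he.zero_mul_isBoundedUnder_le ?_)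
    refine isBoundedUnder_of ⟨1 + t * (1 + t) / (1 + t ^ 2), fun r => ?_⟩
    have hs := abs_le.1 (Real.abs_sin_le_one r)
    have hc := abs_le.1 (Real.abs_cos_le_one r)
    have hb : |Real.sin r - t * Real.cos r| ≤ 1 + t := by
      refine abs_le.2 ⟨?_, ?_⟩ <;> nlinarith
    refine (abs_add_le _ _).trans ?_
    rw [abs_one, abs_div, abs_mul, abs_of_pos ht, abs_of_pos (by positivity : 0 < 1 + t ^ 2)]
    gcongr
  have hi := integrableOn_Ioi_deriv_of_nonneg' (fun r _ => hd r) hnn hlim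
  have hv := integral_Ioi_of_hasDerivAt_of_nonneg' (fun r _ => hd r) hnn hlim
  rw [← ofReal_integral_eq_lintegral_ofReal hi
    (by filter_upwards [ae_restrict_mem measurableSet_Ioi] with r hr using hnn r hr), hv]
  congr 1
  simp only [G, zero_mul, neg_zero, Real.exp_zero, Real.sin_zero, Real.cos_zero]
  field_simp
  ring

/-- Write `1/r²` as `∫ t exp(-r t) dt` and exchange the integrals. In `ENNReal` Tonelli needs no
integrability, which instead follows from the finite value `∫ 1/(1 + t²) dt`. -/
theorem lintegral_one_sub_cos_div_sq :
    ∫⁻ r in Ioi (0 : ℝ), ENNReal.ofReal ((1 - Real.cos r) / r ^ 2) =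
      ENNReal.ofReal (Real.pi / 2) := by
  calc
    _ = ∫⁻ r in Ioi (0 : ℝ), ∫⁻ t in Ioi (0 : ℝ),
          ENNReal.ofReal (t * Real.exp (-(r * t)) * (1 - Real.cos r)) := by
      refine setLIntegral_congr_fun measurableSet_Ioi fun r hr => ?_
      have hc : 0 ≤ 1 - Real.cos r := by linarith [Real.cos_le_one r]
      simp only [ENNReal.ofReal_mul' hc]
      rw [lintegral_mul_const _ (by fun_prop), lintegral_mul_exp_neg_mul hr,
        ← ENNReal.ofReal_mul' hc]
      congr 1; ring
    _ = ∫⁻ t in Ioi (0 : ℝ), ∫⁻ r in Ioi (0 : ℝ),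
          ENNReal.ofReal (t * Real.exp (-(r * t)) * (1 - Real.cos r)) :=
      lintegral_lintegral_swap (by fun_prop)
    _ = ∫⁻ t in Ioi (0 : ℝ), ENNReal.ofReal ((1 + t ^ 2)⁻¹) :=
      setLIntegral_congr_fun measurableSet_Ioi fun t ht => lintegral_exp_mul_one_sub_cos ht
    _ = _ := by
      rw [← ofReal_integral_eq_lintegral_ofReal integrable_inv_one_add_sq.integrableOn
        (Eventually.of_forall fun t => by positivity), integral_Ioi_inv_one_add_sq]
      simp

theorem integrableOn_one_sub_cos_div_sq :
    IntegrableOn (fun r : ℝ => (1 - Real.cos r) / r ^ 2) (Ioi 0) := by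
  have hm : Measurable (fun r : ℝ => (1 - Real.cos r) / r ^ 2) := by fun_prop
  refine ⟨hm.aestronglyMeasurable, ?_⟩
  rw [hasFiniteIntegral_iff_ofReal (Eventually.of_forall fun r =>
    div_nonneg (by linarith [Real.cos_le_one r]) (sq_nonneg r)), lintegral_one_sub_cos_div_sq]
  exact ENNReal.ofReal_lt_top

theorem integral_one_sub_cos_div_sq :
    ∫ r in Ioi (0 : ℝ), (1 - Real.cos r) / r ^ 2 = Real.pi / 2 := by
  rw [integral_eq_lintegral_of_nonneg_ae (Eventually.of_forall fun r =>
      div_nonneg (by linarith [Real.cos_le_one r]) (sq_nonneg r))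
    integrableOn_one_sub_cos_div_sq.aestronglyMeasurable, lintegral_one_sub_cos_div_sq,
    ENNReal.toReal_ofReal (by positivity)]

theorem integrableOn_one_sub_cos_mul_div_sq (a : ℝ) :
    IntegrableOn (fun r : ℝ => (1 - Real.cos (a * r)) / r ^ 2) (Ioi 0) ∧
      ∫ r in Ioi (0 : ℝ), (1 - Real.cos (a * r)) / r ^ 2 = Real.pi / 2 * |a| := by
  wlog ha : 0 < a generalizing a with H
  · rcases (not_lt.1 ha).eq_or_lt with h | h
    · simp [h]
    · simpa [Real.cos_neg] using H (-a) (by linarith)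
  have e : (fun r : ℝ => (1 - Real.cos (a * r)) / r ^ 2) =
      fun r => a ^ 2 * ((fun x : ℝ => (1 - Real.cos x) / x ^ 2) (a * r)) := by
    funext r
    by_cases hr : r = 0
    · simp [hr]
    · field_simp
  rw [e]
  constructor
  · refine Integrable.const_mul ?_ _
    have := (integrableOn_Ioi_comp_mul_left_iff
      (fun x : ℝ => (1 - Real.cos x) / x ^ 2) 0 ha).2
    rw [mul_zero] at this
    exact this integrableOn_one_sub_cos_div_sq
  · rw [integral_const_mul, integral_comp_mul_left_Ioi (fun x : ℝ => (1 - Real.cos x) / x ^ 2) 0 ha,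
      mul_zero, integral_one_sub_cos_div_sq, abs_of_pos ha, smul_eq_mul]
    field_simp

/-! ### Homogeneous kernels of degree `-3` in polar coordinates -/

theorem Plane.measurePreserving_prod :
    MeasurePreserving (fun y : Plane => (y 0, y 1)) volume volume :=
  (volume_preserving_finTwoArrow ℝ).comp (PiLp.volume_preserving_ofLp (Fin 2))

theorem Plane.measurableEmbedding_prod :
    MeasurableEmbedding (fun y : Plane => (y 0, y 1)) :=
  ((MeasurableEquiv.toLp 2 (Fin 2 → ℝ)).symm.trans
    MeasurableEquiv.finTwoArrow).measurableEmbedding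

theorem integrable_polarCoord_iff {f : ℝ × ℝ → ℝ} :
    Integrable f ↔
      IntegrableOn (fun p : ℝ × ℝ => p.1 * f (p.1 * Real.cos p.2, p.1 * Real.sin p.2))
        (Ioi 0 ×ˢ Ioo (-Real.pi) Real.pi) := by
  have h1 : Integrable f ↔ IntegrableOn f polarCoord.source := by
    rw [← integrableOn_univ]
    exact (integrableOn_congr_set_ae polarCoord_source_ae_eq_univ).symm
  rw [h1, ← polarCoord.symm_image_target_eq_source,
    integrableOn_image_iff_integrableOn_abs_det_fderiv_smul volume
      polarCoord.open_target.measurableSet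
      (fun p _ => (hasFDerivAt_polarCoord_symm p).hasFDerivWithinAt) polarCoord.symm.injOn]
  refine integrableOn_congr_fun (fun p hp => ?_) polarCoord.open_target.measurableSet
  rw [det_fderivPolarCoordSymm, abs_of_pos hp.1]
  rfl

/-- The cosine transform of a kernel that is homogeneous of degree `-3`. -/
theorem integral_one_sub_cos_inner_mul {h : ℝ → ℝ → ℝ}
    (hh : ∀ r > 0, ∀ a b, h (r * a) (r * b) = (r ^ 3)⁻¹ * h a b)
    (hc : Continuous fun θ => h (Real.cos θ) (Real.sin θ)) (k : Plane) :
    Integrable (fun y : Plane => (1 - Real.cos (k 0 * y 0 + k 1 * y 1)) * h (y 0) (y 1)) ∧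
    ∫ y : Plane, (1 - Real.cos (k 0 * y 0 + k 1 * y 1)) * h (y 0) (y 1) =
      Real.pi / 2 * ∫ θ in -Real.pi..Real.pi,
        |k 0 * Real.cos θ + k 1 * Real.sin θ| * h (Real.cos θ) (Real.sin θ) := by
  let f : ℝ × ℝ → ℝ := fun p => (1 - Real.cos (k 0 * p.1 + k 1 * p.2)) * h p.1 p.2
  let a : ℝ → ℝ := fun θ => k 0 * Real.cos θ + k 1 * Real.sin θ
  let F : ℝ × ℝ → ℝ := fun p => (1 - Real.cos (a p.2 * p.1)) / p.1 ^ 2 *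
    h (Real.cos p.2) (Real.sin p.2)
  have hpi := Real.pi_pos
  have ha : Continuous a := by fun_prop
  -- The Jacobian `r` against the homogeneity factor `r⁻³` leaves `r⁻²`, so for each angle the
  -- radial integral is the one already computed.
  have hF : EqOn (fun p : ℝ × ℝ => p.1 * f (p.1 * Real.cos p.2, p.1 * Real.sin p.2)) F
      (Ioi 0 ×ˢ Ioo (-Real.pi) Real.pi) := by
    rintro ⟨r, θ⟩ ⟨hr, -⟩
    have hr : 0 < r := hr
    simp only [f, F, a, hh r hr]
    rw [show k 0 * (r * Real.cos θ) + k 1 * (r * Real.sin θ) =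
      (k 0 * Real.cos θ + k 1 * Real.sin θ) * r by ring]
    field_simp
  have hms : MeasurableSet (Ioi (0 : ℝ) ×ˢ Ioo (-Real.pi) Real.pi) :=
    measurableSet_Ioi.prod measurableSet_Ioo
  have hFm : Measurable F := by
    have := hc.measurable.comp (measurable_snd : Measurable (Prod.snd : ℝ × ℝ → ℝ))
    exact Measurable.mul (by fun_prop) this
  have hint : ∀ c : ℝ → ℝ, Continuous c →
      Integrable c (volume.restrict (Ioo (-Real.pi) Real.pi)) := fun c hc =>
    (hc.integrableOn_Icc (a := -Real.pi) (b := Real.pi)).mono_set Ioo_subset_Icc_self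
  have hFi : Integrable F ((volume.restrict (Ioi 0)).prod
      (volume.restrict (Ioo (-Real.pi) Real.pi))) := by
    rw [integrable_prod_iff' hFm.aestronglyMeasurable]
    refine ⟨Eventually.of_forall fun θ =>
      (integrableOn_one_sub_cos_mul_div_sq (a θ)).1.mul_const
        (h (Real.cos θ) (Real.sin θ)), ?_⟩
    have e : (fun θ => ∫ r in Ioi (0 : ℝ), ‖F (r, θ)‖) =
        fun θ => Real.pi / 2 * |a θ| * |h (Real.cos θ) (Real.sin θ)| := by
      funext θ
      rw [← (integrableOn_one_sub_cos_mul_div_sq (a θ)).2, ← integral_mul_const]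
      congr 1; funext r
      rw [Real.norm_eq_abs, abs_mul, abs_of_nonneg (div_nonneg
        (by linarith [Real.cos_le_one (a θ * r)]) (sq_nonneg r))]
    rw [e]
    exact hint _ ((continuous_const.mul ha.abs).mul hc.abs)
  have hrestr : (volume.restrict (Ioi (0 : ℝ))).prod
      (volume.restrict (Ioo (-Real.pi) Real.pi)) =
      (volume : Measure (ℝ × ℝ)).restrict (Ioi 0 ×ˢ Ioo (-Real.pi) Real.pi) :=
    Measure.prod_restrict _ _
  have hfi : Integrable f := by
    rw [integrable_polarCoord_iff, integrableOn_congr_fun hF hms, IntegrableOn, ← hrestr]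
    exact hFi
  refine ⟨Plane.measurePreserving_prod.integrable_comp_of_integrable hfi, ?_⟩
  calc
    _ = ∫ p, f p := Plane.measurePreserving_prod.integral_comp
          Plane.measurableEmbedding_prod f
    _ = ∫ p in Ioi 0 ×ˢ Ioo (-Real.pi) Real.pi, F p := by
      rw [← integral_comp_polarCoord_symm f]
      exact setIntegral_congr_fun hms hF
    _ = ∫ θ in Ioo (-Real.pi) Real.pi, ∫ r in Ioi (0 : ℝ), F (r, θ) := by
      rw [← hrestr, integral_prod_symm _ hFi]
    _ = ∫ θ in Ioo (-Real.pi) Real.pi,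
          Real.pi / 2 * (|a θ| * h (Real.cos θ) (Real.sin θ)) := by
      congr 1; funext θ
      simp only [F]
      rw [integral_mul_const, (integrableOn_one_sub_cos_mul_div_sq (a θ)).2, mul_assoc]
    _ = _ := by
      rw [integral_const_mul, intervalIntegral.integral_of_le (by linarith),
        integral_Ioc_eq_integral_Ioo]

/-! ### The angular integral -/

theorem kernel_cos_sin (β θ : ℝ) : kernel β (Real.cos θ) (Real.sin θ) =
    kernelNum β (Real.cos θ) (Real.sin θ) / kernelForm β (Real.cos θ) (Real.sin θ) ^ 3 := by
  simp [kernel]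

theorem kernelForm_cos_sin_pos {β : ℝ} (hβ : 0 < β) (θ : ℝ) :
    0 < kernelForm β (Real.cos θ) (Real.sin θ) :=
  kernelForm_pos hβ (by simp)

theorem continuous_kernel_cos_sin {β : ℝ} (hβ : 0 < β) :
    Continuous fun θ => kernel β (Real.cos θ) (Real.sin θ) := by
  simp only [kernel_cos_sin]
  refine Continuous.div (by unfold kernelNum; fun_prop) (by unfold kernelForm; fun_prop) fun θ => ?_
  have := kernelForm_cos_sin_pos hβ θ
  positivity

theorem hasDerivAt_kernelForm_cos_sin (β θ : ℝ) :
    HasDerivAt (fun θ => kernelForm β (Real.cos θ) (Real.sin θ))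
      (2 * (β - 1) * Real.cos θ * Real.sin θ) θ := by
  unfold kernelForm
  refine (((Real.hasDerivAt_cos θ).pow 2).add
    (((Real.hasDerivAt_sin θ).pow 2).const_mul β)).congr_deriv ?_
  simp; ring

/-- On the unit circle the kernel is `μ'' + μ` with `μ = 1 / (cos² θ + β sin² θ)`, so
`cos (θ - φ) μ' + sin (θ - φ) μ` is a primitive of `cos (θ - φ)` times the kernel. -/
theorem hasDerivAt_cosine_primitive {β : ℝ} (hβ : 0 < β) (φ θ : ℝ) :
    HasDerivAt (fun θ => Real.cos (θ - φ) * (-(2 * (β - 1) * Real.cos θ * Real.sin θ) /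
        kernelForm β (Real.cos θ) (Real.sin θ) ^ 2) +
        Real.sin (θ - φ) * (1 / kernelForm β (Real.cos θ) (Real.sin θ)))
      (Real.cos (θ - φ) * kernel β (Real.cos θ) (Real.sin θ)) θ := by
  have hD := hasDerivAt_kernelForm_cos_sin β θ
  have hD0 := (kernelForm_cos_sin_pos hβ θ).ne'
  have hφ : HasDerivAt (fun θ => θ - φ) 1 θ := (hasDerivAt_id θ).sub_const φ
  have hn : HasDerivAt (fun θ => -(2 * (β - 1) * Real.cos θ * Real.sin θ))
      (-(2 * (β - 1) * (-Real.sin θ) * Real.sin θ + 2 * (β - 1) * Real.cos θ * Real.cos θ)) θ :=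
    (((Real.hasDerivAt_cos θ).const_mul (2 * (β - 1))).mul (Real.hasDerivAt_sin θ)).neg
  refine ((hφ.cos.mul (hn.div (hD.pow 2) (by simpa using hD0))).add
    (hφ.sin.mul ((hasDerivAt_const θ (1 : ℝ)).div hD hD0))).congr_deriv ?_
  simp only [kernel_cos_sin, Pi.div_apply, Pi.pow_apply]
  field_simp
  simp only [kernelForm, kernelNum]
  ring

/-- The integrand is `π`-periodic, so the integral is twice that over `[φ - π/2, φ + π/2]`, where
`cos (θ - φ) ≥ 0` and the explicit primitive applies. At both ends the cosine vanishes, leaving `μ(φ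
+ π/2) + μ(φ - π/2) = 2 / (β cos² φ + sin² φ)`. -/
theorem integral_abs_cos_sub_mul_kernel {β : ℝ} (hβ : 0 < β) (φ : ℝ) :
    ∫ θ in -Real.pi..Real.pi, |Real.cos (θ - φ)| * kernel β (Real.cos θ) (Real.sin θ) =
      4 / (β * Real.cos φ ^ 2 + Real.sin φ ^ 2) := by
  set g : ℝ → ℝ := fun θ => |Real.cos (θ - φ)| * kernel β (Real.cos θ) (Real.sin θ) with hg
  have hgc : Continuous g := by
    have := continuous_kernel_cos_sin hβ
    fun_prop
  have hper : Function.Periodic g Real.pi := fun θ => by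
    simp only [hg, kernel_cos_sin, kernelNum, kernelForm, Real.cos_add_pi, Real.sin_add_pi, neg_sq,
      Even.neg_pow (by decide : Even 4), show θ + Real.pi - φ = θ - φ + Real.pi by ring, abs_neg]
  have hii (a b : ℝ) : IntervalIntegrable g volume a b := hgc.intervalIntegrable a b
  have hshift (s : ℝ) : ∫ θ in s..s + Real.pi, g θ =
      ∫ θ in (φ - Real.pi / 2)..(φ - Real.pi / 2 + Real.pi), g θ :=
    hper.intervalIntegral_add_eq _ _
  have hhalf : ∫ θ in (φ - Real.pi / 2)..(φ - Real.pi / 2 + Real.pi), g θ =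
      2 / (β * Real.cos φ ^ 2 + Real.sin φ ^ 2) := by
    have hle : φ - Real.pi / 2 ≤ φ - Real.pi / 2 + Real.pi := by linarith [Real.pi_pos]
    have e : ∫ θ in (φ - Real.pi / 2)..(φ - Real.pi / 2 + Real.pi), g θ =
        ∫ θ in (φ - Real.pi / 2)..(φ - Real.pi / 2 + Real.pi),
          Real.cos (θ - φ) * kernel β (Real.cos θ) (Real.sin θ) := by
      refine intervalIntegral.integral_congr fun θ hθ => ?_
      rw [uIcc_of_le hle] at hθ
      simp only [hg]
      rw [abs_of_nonneg (Real.cos_nonneg_of_mem_Icc ⟨by linarith [hθ.1], by linarith [hθ.2]⟩)]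
    rw [e, intervalIntegral.integral_eq_sub_of_hasDerivAt
      (fun θ _ => hasDerivAt_cosine_primitive hβ φ θ)
      (Continuous.intervalIntegrable (by have := continuous_kernel_cos_sin hβ; fun_prop) _ _)]
    rw [show φ - Real.pi / 2 + Real.pi = φ + Real.pi / 2 by ring, add_sub_cancel_left,
      sub_sub_cancel_left]
    simp only [Real.cos_neg, Real.cos_pi_div_two, Real.sin_neg, Real.sin_pi_div_two, kernelForm,
      Real.cos_add_pi_div_two, Real.sin_add_pi_div_two, Real.cos_sub_pi_div_two,
      Real.sin_sub_pi_div_two]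
    ring
  have hsplit : ∫ θ in -Real.pi..Real.pi, g θ =
      (∫ θ in -Real.pi..-Real.pi + Real.pi, g θ) + ∫ θ in (0 : ℝ)..0 + Real.pi, g θ := by
    rw [neg_add_cancel, zero_add]
    exact (intervalIntegral.integral_add_adjacent_intervals (hii _ _) (hii _ _)).symm
  rw [hsplit, hshift (-Real.pi), hshift 0, hhalf]
  ring

/-- The cosine transform of the kernel is the symbol. -/
theorem integral_one_sub_cos_mul_kernel {β : ℝ} (hβ : 0 < β) (k : Plane) :
    ∫ y : Plane, (1 - Real.cos (k 0 * y 0 + k 1 * y 1)) * kernel β (y 0) (y 1) =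
      2 * Real.pi * symbol β k := by
  rw [(integral_one_sub_cos_inner_mul (fun r hr a b => kernel_smul β hr a b)
    (continuous_kernel_cos_sin hβ) k).2]
  by_cases hk : k = 0
  · simp [hk, symbol]
  have hS := Plane.sq_add_sq_pos hk
  have hz : (⟨k 0, k 1⟩ : ℂ) ≠ 0 := by
    intro h
    have h1 := congrArg Complex.re h
    have h2 := congrArg Complex.im h
    simp only [Complex.zero_re, Complex.zero_im] at h1 h2
    rw [h1, h2] at hS
    simp at hS
  have hn : ‖(⟨k 0, k 1⟩ : ℂ)‖ = ‖k‖ := by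
    rw [Complex.norm_def, Complex.normSq_apply, Plane.norm_eq]; congr 1; ring
  have hk0 : 0 < ‖k‖ := norm_pos_iff.2 hk
  have h0 : k 0 = ‖k‖ * Real.cos (angle k) := by
    rw [angle, Complex.cos_arg hz, hn]; field_simp
  have h1 : k 1 = ‖k‖ * Real.sin (angle k) := by
    rw [angle, Complex.sin_arg, hn]; field_simp
  have e (θ : ℝ) : |k 0 * Real.cos θ + k 1 * Real.sin θ| * kernel β (Real.cos θ) (Real.sin θ) =
      ‖k‖ * (|Real.cos (θ - angle k)| * kernel β (Real.cos θ) (Real.sin θ)) := by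
    have : k 0 * Real.cos θ + k 1 * Real.sin θ = ‖k‖ * Real.cos (θ - angle k) := by
      rw [Real.cos_sub, mul_add, ← mul_assoc, ← mul_assoc, mul_right_comm, ← h0,
        mul_right_comm, ← h1]
    rw [this, abs_mul, abs_of_pos hk0, mul_assoc]
  simp only [e]
  rw [intervalIntegral.integral_const_mul, integral_abs_cos_sub_mul_kernel hβ, symbol]
  have hf := profileForm_pos hβ (angle k)
  rw [profileForm] at hf
  rw [show β * k 0 ^ 2 + k 1 ^ 2 =
    ‖k‖ ^ 2 * (β * Real.cos (angle k) ^ 2 + Real.sin (angle k) ^ 2) by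
      rw [mul_add, mul_left_comm, ← mul_pow, ← mul_pow, ← h0, ← h1]]
  field_simp
  norm_num

end PeierlsNabarro

end

noncomputable section

namespace PeierlsNabarro

open MeasureTheory Set Filter Topology

/-! ### The multiplier operator as a singular integral -/

theorem measurable_kernel (β : ℝ) : Measurable fun y : Plane => kernel β (y 0) (y 1) := by
  unfold kernel kernelNum kernelForm
  fun_prop

theorem Plane.inner_eq (v w : Plane) : inner ℝ v w = v 0 * w 0 + v 1 * w 1 := by
  simp [PiLp.inner_apply, Fin.sum_univ_two, mul_comm]

theorem one_sub_cos_nonneg (x : ℝ) : 0 ≤ 1 - Real.cos x := by linarith [Real.cos_le_one x]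

theorem integrable_one_sub_cos_mul_kernel {β : ℝ} (hβ : 0 < β) (k : Plane) :
    Integrable fun y : Plane =>
      (1 - Real.cos (k 0 * y 0 + k 1 * y 1)) * kernel β (y 0) (y 1) :=
  (integral_one_sub_cos_inner_mul (fun _ hr a b => kernel_smul β hr a b)
    (continuous_kernel_cos_sin hβ) k).1

/-- Fubini's theorem needs this bound with the absolute value, since the kernel can be negative:
`kernel 2 1 0 = -1`. -/
theorem exists_integral_one_sub_cos_mul_abs_kernel_le {β : ℝ} (hβ : 0 < β) :
    ∃ C : ℝ, ∀ k : Plane,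
      ∫ y : Plane, (1 - Real.cos (k 0 * y 0 + k 1 * y 1)) * |kernel β (y 0) (y 1)| ≤ C * ‖k‖ := by
  have hκ := (continuous_kernel_cos_sin hβ).abs
  refine ⟨Real.pi / 2 * ∫ θ in -Real.pi..Real.pi, |kernel β (Real.cos θ) (Real.sin θ)|,
    fun k => ?_⟩
  rw [(integral_one_sub_cos_inner_mul (h := fun a b => |kernel β a b|)
    (fun r hr a b => by rw [kernel_smul β hr, abs_mul, abs_of_pos (by positivity)]) hκ k).2,
    mul_assoc, ← intervalIntegral.integral_mul_const]
  gcongr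
  refine intervalIntegral.integral_mono_on (by linarith [Real.pi_pos])
    (Continuous.intervalIntegrable (by fun_prop) _ _)
    (Continuous.intervalIntegrable (by fun_prop) _ _) fun θ _ => ?_
  rw [mul_comm]
  gcongr
  rw [Plane.norm_eq]
  refine Real.abs_le_sqrt ?_
  have := Real.sin_sq_add_cos_sq θ
  nlinarith [sq_nonneg (k 0 * Real.sin θ - k 1 * Real.cos θ)]

/-- The phase `2π ⟨ξ, y⟩` written with the angular frequency `2π ξ`. -/
def phase (ξ y : Plane) : ℝ :=
  ((2 * Real.pi) • ξ) 0 * y 0 + ((2 * Real.pi) • ξ) 1 * y 1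

theorem phase_eq (ξ y : Plane) : phase ξ y = 2 * Real.pi * inner ℝ ξ y := by
  simp [phase, Plane.inner_eq]; ring

/-- The double integrand that Fubini's theorem is applied to. -/
def fubiniIntegrand (β : ℝ) (u : 𝓢(Plane, ℂ)) (x : Plane) (p : Plane × Plane) : ℂ :=
  Complex.exp ((phase p.1 x : ℝ) * Complex.I) * 𝓕 (u : Plane → ℂ) p.1 *
    ((-2 * ((1 - Real.cos (phase p.1 p.2)) * kernel β (p.2 0) (p.2 1)) : ℝ) : ℂ)

theorem continuous_fourier (u : 𝓢(Plane, ℂ)) : Continuous (𝓕 (u : Plane → ℂ)) := by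
  rw [← SchwartzMap.fourier_coe]
  exact (𝓕 u).continuous

theorem integrable_fourier (u : 𝓢(Plane, ℂ)) : Integrable (𝓕 (u : Plane → ℂ)) := by
  rw [← SchwartzMap.fourier_coe]
  exact (𝓕 u).integrable

/-- The `y`-integral of the norm grows at most linearly in `ξ`, and `‖ξ‖` times the transform of a
Schwartz function is integrable. -/
theorem integrable_fubiniIntegrand {β : ℝ} (hβ : 0 < β) (u : 𝓢(Plane, ℂ)) (x : Plane) :
    Integrable (fubiniIntegrand β u x) := by
  have hm : AEStronglyMeasurable (fubiniIntegrand β u x) (volume.prod volume) := by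
    have h1 := (continuous_fourier u).measurable
    have h2 := (measurable_kernel β).comp (measurable_snd : Measurable (Prod.snd : Plane × Plane → _))
    have h3 := h1.comp (measurable_fst : Measurable (Prod.fst : Plane × Plane → _))
    have h4 : Measurable fun p : Plane × Plane => Complex.exp ((phase p.1 x : ℝ) * Complex.I) := by
      simp only [phase_eq]; fun_prop
    have h5 : Measurable fun p : Plane × Plane => Real.cos (phase p.1 p.2) := by
      simp only [phase_eq]; fun_prop
    refine Measurable.aestronglyMeasurable ((h4.mul h3).mul ?_)
    exact Complex.measurable_ofReal.comp
      (measurable_const.mul ((measurable_const.sub h5).mul h2))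
  obtain ⟨C, hC⟩ := exists_integral_one_sub_cos_mul_abs_kernel_le hβ
  refine (integrable_prod_iff hm).2 ⟨Eventually.of_forall fun ξ => ?_, ?_⟩
  · exact (((integrable_one_sub_cos_mul_kernel hβ ((2 * Real.pi) • ξ)).const_mul
      (-2)).ofReal (𝕜 := ℂ)).const_mul
      (Complex.exp ((phase ξ x : ℝ) * Complex.I) * 𝓕 (u : Plane → ℂ) ξ)
  · have hb : Integrable fun ξ : Plane =>
        4 * Real.pi * C * (‖ξ‖ ^ 1 * ‖𝓕 (u : Plane → ℂ) ξ‖) := by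
      rw [← SchwartzMap.fourier_coe]
      exact ((𝓕 u).integrable_pow_mul volume 1).const_mul _
    refine hb.mono' hm.norm.integral_prod_right' (Eventually.of_forall fun ξ => ?_)
    have e (y : Plane) : ‖fubiniIntegrand β u x (ξ, y)‖ = 2 * ‖𝓕 (u : Plane → ℂ) ξ‖ *
        ((1 - Real.cos (phase ξ y)) * |kernel β (y 0) (y 1)|) := by
      simp only [fubiniIntegrand]
      rw [norm_mul, norm_mul, Complex.norm_exp_ofReal_mul_I, Complex.norm_real, Real.norm_eq_abs,
        abs_mul, abs_mul, abs_of_nonneg (one_sub_cos_nonneg _)]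
      norm_num
      ring
    simp only [e]
    rw [integral_const_mul, Real.norm_of_nonneg (mul_nonneg (by positivity)
      (integral_nonneg fun y => mul_nonneg (one_sub_cos_nonneg _) (abs_nonneg _)))]
    have := hC ((2 * Real.pi) • ξ)
    rw [norm_smul, Real.norm_of_nonneg (by positivity)] at this
    calc _ ≤ 2 * ‖𝓕 (u : Plane → ℂ) ξ‖ * (C * (2 * Real.pi * ‖ξ‖)) := by gcongr; exact this
      _ = _ := by ring

theorem integral_fubiniIntegrand_right {β : ℝ} (hβ : 0 < β) (u : 𝓢(Plane, ℂ)) (x ξ : Plane) :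
    ∫ y, fubiniIntegrand β u x (ξ, y) =
      -(4 * (Real.pi : ℂ)) * (Complex.exp ((phase ξ x : ℝ) * Complex.I) * multiplied β u ξ) := by
  have h := integral_one_sub_cos_mul_kernel hβ ((2 * Real.pi) • ξ)
  simp only [fubiniIntegrand]
  rw [integral_const_mul, integral_complex_ofReal, integral_const_mul]
  simp only [phase] at h ⊢
  rw [h, multiplied]
  push_cast
  ring

theorem schwartz_eq_integral_fourier (u : 𝓢(Plane, ℂ)) (x : Plane) :
    u x = ∫ ξ, Complex.exp ((phase ξ x : ℝ) * Complex.I) * 𝓕 (u : Plane → ℂ) ξ := by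
  have h := u.continuous.fourierInv_fourier_eq u.integrable (integrable_fourier u)
  conv_lhs => rw [← h, Real.fourierInv_eq']
  simp only [phase_eq, smul_eq_mul]

theorem integrable_exp_mul_fourier (u : 𝓢(Plane, ℂ)) (x : Plane) :
    Integrable fun ξ =>
      Complex.exp ((phase ξ x : ℝ) * Complex.I) * 𝓕 (u : Plane → ℂ) ξ := by
  refine (integrable_fourier u).bdd_mul (c := 1) ?_ (Eventually.of_forall fun ξ => ?_)
  · simp only [phase_eq]
    exact Continuous.aestronglyMeasurable (by fun_prop)
  · rw [Complex.norm_exp_ofReal_mul_I]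

/-- Fourier inversion at `x + y`, `x - y` and `x`, combined with `exp(iφ) + exp(-iφ) - 2 = -2 (1 -
cos φ)`. -/
theorem integral_fubiniIntegrand_left (β : ℝ) (u : 𝓢(Plane, ℂ)) (x y : Plane) :
    ∫ ξ, fubiniIntegrand β u x (ξ, y) =
      (u (x + y) + u (x - y) - 2 * u x) * (kernel β (y 0) (y 1) : ℂ) := by
  have hi := integrable_exp_mul_fourier u
  rw [schwartz_eq_integral_fourier u (x + y), schwartz_eq_integral_fourier u (x - y),
    schwartz_eq_integral_fourier u x, ← integral_add (hi _) (hi _), ← integral_const_mul,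
    ← integral_sub ((hi _).fun_add (hi _)) ((hi _).const_mul _), ← integral_mul_const]
  congr 1; funext ξ
  have hadd : phase ξ (x + y) = phase ξ x + phase ξ y := by
    simp only [phase_eq, inner_add_right]; ring
  have hsub : phase ξ (x - y) = phase ξ x - phase ξ y := by
    simp only [phase_eq, inner_sub_right]; ring
  simp only [fubiniIntegrand, hadd, hsub]
  push_cast
  rw [Complex.cos, sub_eq_add_neg (phase ξ x : ℂ), add_mul (phase ξ x : ℂ),
    add_mul (phase ξ x : ℂ), Complex.exp_add, Complex.exp_add]
  ring

theorem multiplier_integral_formula {β : ℝ} (hβ : 0 < β) (u : 𝓢(Plane, ℂ)) :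
    Integrable (multiplied β u) ∧ ∀ x : Plane,
      Integrable (integrand β (profile β) u x) ∧
      multiplierOp β u x =
        -(1 / (4 * (Real.pi : ℂ))) * ∫ y : Plane, integrand β (profile β) u x y := by
  have hpi : (Real.pi : ℂ) ≠ 0 := by exact_mod_cast Real.pi_ne_zero
  have hint (x y : Plane) : integrand β (profile β) u x y =
      ∫ ξ, fubiniIntegrand β u x (ξ, y) := by
    rw [integral_fubiniIntegrand_left, integrand, K_profile_eq_kernel hβ]
  refine ⟨?_, fun x => ⟨?_, ?_⟩⟩
  -- At `x = 0` the exponential is `1`, so integrating out `y` leaves `-4π` times `multiplied β u`,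
  -- integrable by Fubini's theorem.
  · have h := (integrable_fubiniIntegrand hβ u 0).integral_prod_left
    simp only [integral_fubiniIntegrand_right hβ] at h
    refine (h.const_mul (-(4 * (Real.pi : ℂ)))⁻¹).congr (Eventually.of_forall fun ξ => ?_)
    simp only [phase_eq, inner_zero_right]
    field_simp
    simp
  · exact (integrable_fubiniIntegrand hβ u x).integral_prod_right.congr
      (Eventually.of_forall fun y => (hint x y).symm)
  · simp only [hint]
    rw [integral_integral_swap (f := fun y ξ => fubiniIntegrand β u x (ξ, y))
      (integrable_fubiniIntegrand hβ u x).swap]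
    simp only [integral_fubiniIntegrand_right hβ]
    rw [integral_const_mul, multiplierOp, Real.fourierInv_eq']
    rw [show ∀ z : ℂ, -(1 / (4 * (Real.pi : ℂ))) * (-(4 * (Real.pi : ℂ)) * z) = z from
      fun z => by field_simp]
    simp only [phase_eq, smul_eq_mul]

end PeierlsNabarro

end

theorem proposition3p2 (β : ℝ) (hβ : β ∈ Set.Icc (1 / 2 : ℝ) 2) :
    (∃! v : ℝ → ℝ, PeierlsNabarro.IsAngularProfile β v) ∧
    ∀ v : ℝ → ℝ, PeierlsNabarro.IsAngularProfile β v →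
      -- integral formulation of the multiplier operator
      (∀ u : 𝓢(PeierlsNabarro.Plane, ℂ),
        MeasureTheory.Integrable (PeierlsNabarro.multiplied β u) ∧
        ∀ x : PeierlsNabarro.Plane,
          MeasureTheory.Integrable (PeierlsNabarro.integrand β v u x) ∧
          PeierlsNabarro.multiplierOp β u x =
            -(1 / (4 * (Real.pi : ℂ))) *
              ∫ y : PeierlsNabarro.Plane, PeierlsNabarro.integrand β v u x y) ∧
      -- homogeneity of degree `-3`
      (∀ t : ℝ, 0 < t → ∀ y : PeierlsNabarro.Plane, y ≠ 0 →
        PeierlsNabarro.K β v (t • y) = (t ^ 3)⁻¹ * PeierlsNabarro.K β v y) ∧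
      -- the equation away from the origin, in the classical sense
      ContDiffOn ℝ 2 (PeierlsNabarro.K β v) {0}ᶜ ∧
      ∀ y : PeierlsNabarro.Plane, y ≠ 0 →
        β * PeierlsNabarro.secondPartial 0 (PeierlsNabarro.K β v) y +
          PeierlsNabarro.secondPartial 1 (PeierlsNabarro.K β v) y = 9 / ‖y‖ ^ 5 := by
  have hβ0 : 0 < β := by linarith [hβ.1]
  have hprof := PeierlsNabarro.profile_isAngularProfile hβ0
  refine ⟨⟨_, hprof, fun w hw => hw.unique hprof⟩, fun v hv => ?_⟩
  -- By uniqueness `v` is the closed form, so only the explicit kernel remains to be treated.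
  obtain rfl := hv.unique hprof
  have hK : PeierlsNabarro.K β (PeierlsNabarro.profile β) =
      fun y => PeierlsNabarro.kernel β (y 0) (y 1) :=
    funext fun y => PeierlsNabarro.K_profile_eq_kernel hβ0 y
  refine ⟨PeierlsNabarro.multiplier_integral_formula hβ0, fun t ht y _ => ?_, ?_, fun y hy => ?_⟩
  · simpa [hK] using PeierlsNabarro.kernel_smul β ht (y 0) (y 1)
  · rw [hK]
    exact PeierlsNabarro.contDiffOn_kernel hβ0
  · rw [hK]
    exact PeierlsNabarro.kernel_pde hβ0 hy
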